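/- Let $n\ge 2$, let $p_1,\dots,p_n\in[0,1]$ be neither all equal to $0$ nor all equal to $1$, and let $S_n=I_1+\cdots+I_n$, where $I_1,\dots,I_n$ are independent random variables with $\mathbb P(I_j=1)=p_j$ and $\mathbb P(I_j=0)=1-p_j$. Put $p=\frac1n\sum_{j=1}^n p_j$, $q=1-p$ (so $0<p<1$), $$\delta_m=\frac{1}{n(pq)^{m/2}}\sum_{j=1}^n|p_j-p|^m,\qquad \delta=\delta_2,$$ $b(n,p;k)=\binom nk p^kq^{n-k}$, and let $$\chi^2=\sum_{k=0}^n\left|\frac{\mathbb P(S_n=k)}{b(n,p;k)}-1\right|^2 b(n,p;k)$$ be the $\chi^2$-distance between the law of $S_n$ and the binomial distribution with parameters $n$ and $p$. There is an absolute constant $C>0$ (independent of $n$ and of $p_1,\dots,p_n$) such that, for all such $n$ and $p_1,\dots,p_n$ with $\delta<1$, $$\frac{n}{2(n-1)}\,\delta^2\;\le\;\chi^2\;\le\;\frac{n}{2(n-1)}\,\delta^2\left(1+C\left(\frac{\delta}{1-\delta}+\frac{1}{\sqrt n}\,\frac{\delta_3}{\delta}\right)\right),$$ where $\delta_3/\delta$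 is read as $0$ if $\delta=0$ (that is, if all $p_j$ are equal). -/

import Mathlib

/-- The arithmetic mean `p = (p₁ + ⋯ + pₙ) / n` of the success probabilities, as an element of
the unit interval (with the value `0` when `n = 0`). -/
noncomputable def meanProb {n : ℕ} (p : Fin n → unitInterval) : unitInterval :=
  ⟨(∑ j, (p j : ℝ)) / n, by
    constructor
    · exact div_nonneg (Finset.sum_nonneg fun j _ => (p j).2.1) (Nat.cast_nonneg n)
    · refine div_le_one_of_le₀ ?_ (Nat.cast_nonneg n)
      calc ∑ j, (p j : ℝ) ≤ ∑ _j : Fin n, (1 : ℝ) := Finset.sum_le_sum fun j _ => (p j).2.2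
        _ = n := by simp⟩

/-- `δ_m = (1 / (n (p q)^(m/2))) ∑ⱼ |pⱼ - p|^m`, where `p` is the mean of the `pⱼ` and
`q = 1 - p`. -/
noncomputable def deltaM {n : ℕ} (p : Fin n → unitInterval) (m : ℕ) : ℝ :=
  1 / ((n : ℝ) * ((meanProb p : ℝ) * (1 - (meanProb p : ℝ))) ^ ((m : ℝ) / 2)) *
    ∑ j, |(p j : ℝ) - (meanProb p : ℝ)| ^ m

/-- The `χ²`-distance `∑_{k=0}^n |P{k} / Q{k} - 1|² Q{k}` of two laws `P`, `Q` carried by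
`{0, …, n}`, where every point of `{0, …, n}` has positive `Q`-mass. -/
noncomputable def chiSqDist (n : ℕ) (P Q : MeasureTheory.Measure ℕ) : ℝ :=
  ∑ k ∈ Finset.range (n + 1), |P.real {k} / Q.real {k} - 1| ^ 2 * Q.real {k}

open Finset

/-! Put `a j = p j - p`, so `∑ a j = 0`. The generating function `∏ ((q x + p y) + a j (y - x))`
expands in Krawtchouk form with coefficients `e_l(a)`, and `sum_sq_div_binomial_eq` turns this into
`χ² + 1 = ∑ c l`, where `c l = e_l(a)² / ((p q)^l * n.choose l)`. Here `c 0 = 1`, `c 1 = 0`, and `c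
2` is exactly the claimed main term; as all `c l ≥ 0`, the lower bound follows.

For the tail, `sum_sq_elemSymm_div_choose_le` gives `∑ c l * s^l ≤ 1 / (1 - δ s)`: Parseval on the
unit circle and AM-GM bound the sums of `e_l²`, and a Beta integral supplies `1 / n.choose l`. A
suitable `s` makes the terms `l ≥ 3` of order `δ³ / (1 - δ)`. -/

/-! ### Elementary symmetric functions. -/

/-- The `l`-th elementary symmetric function of a finite family. -/
def elemSymm {R : Type*} [CommRing R] {n : ℕ} (a : Fin n → R) (l : ℕ) : R :=
  ∑ t ∈ powersetCard l univ, ∏ i ∈ t, a i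

theorem map_elemSymm {R S : Type*} [CommRing R] [CommRing S] {n : ℕ} (f : R →+* S)
    (a : Fin n → R) (l : ℕ) : elemSymm (fun i => f (a i)) l = f (elemSymm a l) := by
  simp [elemSymm, map_sum, map_prod]

theorem prod_add_mul_eq_sum_elemSymm {R : Type*} [CommRing R] {n : ℕ} (a : Fin n → R) (x y : R) :
    ∏ j, (a j * y + x) = ∑ l ∈ range (n + 1), elemSymm a l * y ^ l * x ^ (n - l) := by
  classical
  rw [prod_add, sum_powerset]
  simp only [card_univ, Fintype.card_fin]
  refine sum_congr rfl fun l _ => ?_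
  rw [elemSymm, sum_mul, sum_mul]
  refine sum_congr rfl fun t ht => ?_
  have hc := (mem_powersetCard.1 ht).2
  rw [prod_mul_distrib, prod_const, prod_const, hc, card_sdiff_of_subset (subset_univ t), hc,
    card_univ, Fintype.card_fin]

theorem elemSymm_zero {R : Type*} [CommRing R] {n : ℕ} (a : Fin n → R) : elemSymm a 0 = 1 := by
  simp [elemSymm]

theorem elemSymm_one {R : Type*} [CommRing R] {n : ℕ} (a : Fin n → R) :
    elemSymm a 1 = ∑ i, a i := by
  simp [elemSymm, powersetCard_one]

theorem sum_sq_eq_sum_sq_add_two_mul {R ι : Type*} [CommRing R] [DecidableEq ι] (a : ι → R)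
    (s : Finset ι) :
    (∑ i ∈ s, a i) ^ 2 = ∑ i ∈ s, a i ^ 2 + 2 * ∑ t ∈ powersetCard 2 s, ∏ i ∈ t, a i := by
  induction s using Finset.induction_on with
  | empty => simp [powersetCard_eq_empty.2 (show #(∅ : Finset ι) < 2 by simp)]
  | insert i s hi ih =>
    have hdisj : Disjoint (powersetCard 2 s) ((powersetCard 1 s).image (insert i)) := by
      rw [disjoint_left]
      intro t ht ht'
      obtain ⟨u, -, rfl⟩ := mem_image.1 ht'
      exact hi ((mem_powersetCard.1 ht).1 (mem_insert_self i u))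
    have hinj : Set.InjOn (insert i) (powersetCard 1 s : Set (Finset ι)) := by
      intro u hu v hv h
      have hu' : i ∉ u := fun h' => hi ((mem_powersetCard.1 hu).1 h')
      have hv' : i ∉ v := fun h' => hi ((mem_powersetCard.1 hv).1 h')
      rw [← erase_insert hu', ← erase_insert hv']
      exact congrArg (fun w => w.erase i) h
    rw [powersetCard_succ_insert hi, sum_union hdisj, sum_image hinj, sum_insert hi,
      sum_insert hi, powersetCard_one, sum_map]
    have : ∀ x ∈ s, ∏ j ∈ insert i ({x} : Finset ι), a j = a i * a x := by
      intro x hx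
      rw [prod_insert, prod_singleton]
      rw [mem_singleton]
      rintro rfl
      exact hi hx
    simp only [Function.Embedding.coeFn_mk]
    rw [sum_congr rfl this, ← mul_sum]
    linear_combination ih

theorem two_mul_elemSymm_two {R : Type*} [CommRing R] {n : ℕ} (a : Fin n → R) :
    2 * elemSymm a 2 = (∑ i, a i) ^ 2 - ∑ i, a i ^ 2 := by
  rw [sum_sq_eq_sum_sq_add_two_mul, elemSymm]
  ring

/-! ### Krawtchouk expansion and Parseval's identity. -/

open Polynomial in
theorem coeff_C_add_C_mul_X_pow (n k : ℕ) (x y : ℝ) :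
    ((C x + C y * X) ^ n).coeff k = n.choose k * y ^ k * x ^ (n - k) := by
  rw [add_comm, add_pow, finsetSum_coeff]
  have h : ∀ m ∈ range (n + 1), ((C y * X) ^ m * C x ^ (n - m) * ((n.choose m : ℕ) : ℝ[X])).coeff k
      = if k = m then n.choose m * y ^ m * x ^ (n - m) else 0 := by
    intro m _
    have : (C y * X) ^ m * C x ^ (n - m) * ((n.choose m : ℕ) : ℝ[X])
        = C (n.choose m * y ^ m * x ^ (n - m)) * X ^ m := by
      simp only [map_mul, map_pow, map_natCast]
      ring
    rw [this, coeff_C_mul_X_pow]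
  rw [sum_congr rfl h, sum_ite_eq]
  split_ifs with hk
  · rfl
  · rw [Nat.choose_eq_zero_of_lt (by simpa using hk)]
    simp

theorem eq_of_forall_sum_mul_pow_eq {n : ℕ} {c d : ℕ → ℝ}
    (h : ∀ v : ℝ, ∑ l ∈ range (n + 1), c l * v ^ l = ∑ l ∈ range (n + 1), d l * v ^ l)
    {l : ℕ} (hl : l ∈ range (n + 1)) : c l = d l := by
  have h' : ∑ l ∈ range (n + 1), Polynomial.C (c l) * Polynomial.X ^ l
      = ∑ l ∈ range (n + 1), Polynomial.C (d l) * Polynomial.X ^ l := by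
    refine Polynomial.funext fun v => ?_
    simpa [Polynomial.eval_finsetSum] using h v
  have := congrArg (fun P => Polynomial.coeff P l) h'
  simp only [Polynomial.finsetSum_coeff, Polynomial.coeff_C_mul_X_pow, sum_ite_eq] at this
  simpa [mem_range.1 hl] using this

open Polynomial in
/-- Parseval's identity for the expansion of the law of a Poisson binomial variable in Krawtchouk
polynomials. -/
theorem sum_sq_div_binomial_eq {n : ℕ} (a : Fin n → ℝ) {p q : ℝ} (hp : p ≠ 0) (hq : q ≠ 0)
    (hpq : p + q = 1) (P : ℕ → ℝ)
    (hP : ∀ x y : ℝ, ∑ k ∈ range (n + 1), P k * y ^ k * x ^ (n - k) =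
      ∏ j, ((q - a j) * x + (p + a j) * y)) :
    ∑ k ∈ range (n + 1), P k ^ 2 / (n.choose k * p ^ k * q ^ (n - k)) =
      ∑ l ∈ range (n + 1), elemSymm a l ^ 2 / ((p * q) ^ l * n.choose l) := by
  -- Up to normalization, the coefficients of `G l` are binomial weights times the `l`-th Krawtchouk
  -- polynomial.
  set G : ℕ → ℝ[X] := fun l => (X - 1) ^ l * (C q + C p * X) ^ (n - l) with hG
  have h1 : ∀ k ∈ range (n + 1), P k = ∑ l ∈ range (n + 1), elemSymm a l * (G l).coeff k := by
    intro k hk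
    have hpoly : ∑ k ∈ range (n + 1), C (P k) * X ^ k
        = ∑ l ∈ range (n + 1), C (elemSymm a l) * G l := by
      have : ∑ l ∈ range (n + 1), C (elemSymm a l) * G l
          = ∏ j, (C (a j) * (X - 1) + (C q + C p * X)) := by
        rw [prod_add_mul_eq_sum_elemSymm (fun j => C (a j))]
        exact sum_congr rfl fun l _ => by rw [map_elemSymm, hG, mul_assoc]
      rw [this]
      refine Polynomial.funext fun w => ?_
      have := hP 1 w
      simp only [one_pow, mul_one] at this
      simp only [eval_finsetSum, eval_prod, eval_mul, eval_add, eval_C, eval_pow, eval_X, eval_sub,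
        eval_one]
      rw [this]
      exact prod_congr rfl fun j _ => by ring
    have := congrArg (fun Q => coeff Q k) hpoly
    simp only [finsetSum_coeff, coeff_C_mul, coeff_X_pow, mul_ite, mul_one,
      mul_zero, sum_ite_eq] at this
    rwa [if_pos hk] at this
  have hb : ∀ k ∈ range (n + 1), (n.choose k : ℝ) ≠ 0 := fun k hk => by
    exact_mod_cast (Nat.choose_pos (by simpa [Nat.lt_succ_iff] using hk)).ne'
  -- Dual formula: pairing `P / b` with `G l` recovers `e_l(a)`. It is read off from `hP` at `x = 1
  -- - v / q`, `y = 1 + v / p`, so no orthogonality relation has to be computed.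
  have h2 : ∀ v : ℝ, ∑ l ∈ range (n + 1),
      (n.choose l * ∑ k ∈ range (n + 1), P k / (n.choose k * p ^ k * q ^ (n - k)) * (G l).coeff k)
        * v ^ l = ∑ l ∈ range (n + 1), (elemSymm a l / (p * q) ^ l) * v ^ l := by
    intro v
    have hexp : ∀ k, ∑ l ∈ range (n + 1), n.choose l * v ^ l * (G l).coeff k
        = n.choose k * (p + v) ^ k * (q - v) ^ (n - k) := by
      intro k
      rw [← coeff_C_add_C_mul_X_pow,
        show C (q - v) + C (p + v) * X = C v * (X - 1) + (C q + C p * X) by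
          simp only [map_sub, map_add]; ring, add_pow, finsetSum_coeff]
      refine sum_congr rfl fun l _ => ?_
      rw [← coeff_C_mul]
      congr 1
      simp only [hG, map_mul, map_pow, map_natCast, mul_pow]
      ring
    calc _ = ∑ k ∈ range (n + 1), P k / (n.choose k * p ^ k * q ^ (n - k)) *
          ∑ l ∈ range (n + 1), n.choose l * v ^ l * (G l).coeff k := by
          simp only [mul_sum, sum_mul]
          rw [sum_comm]
          exact sum_congr rfl fun _ _ => sum_congr rfl fun _ _ => by ring
      _ = ∑ k ∈ range (n + 1), P k * (1 + v / p) ^ k * (1 - v / q) ^ (n - k) := by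
          refine sum_congr rfl fun k hk => ?_
          have := hb k hk
          rw [hexp, show 1 + v / p = (p + v) / p by field_simp,
            show 1 - v / q = (q - v) / q by field_simp, div_pow, div_pow]
          field_simp
      _ = ∏ j, (a j * (v / (p * q)) + 1) := by
          rw [hP]
          refine prod_congr rfl fun j _ => ?_
          field_simp
          linear_combination (v * a j + p * q) * hpq
      _ = _ := by
          rw [prod_add_mul_eq_sum_elemSymm]
          exact sum_congr rfl fun l _ => by rw [one_pow, mul_one, div_pow]; ring
  calc _ = ∑ k ∈ range (n + 1), P k / (n.choose k * p ^ k * q ^ (n - k)) *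
        ∑ l ∈ range (n + 1), elemSymm a l * (G l).coeff k :=
        sum_congr rfl fun k hk => by rw [← h1 k hk]; ring
    _ = ∑ l ∈ range (n + 1), elemSymm a l * ∑ k ∈ range (n + 1),
          P k / (n.choose k * p ^ k * q ^ (n - k)) * (G l).coeff k := by
        simp only [mul_sum]
        rw [sum_comm]
        exact sum_congr rfl fun _ _ => sum_congr rfl fun _ _ => by ring
    _ = _ := by
        refine sum_congr rfl fun l hl => ?_
        have h3 := eq_of_forall_sum_mul_pow_eq h2 hl
        have h4 := hb l hl
        have h5 := eq_div_of_mul_eq h4 ((mul_comm _ _).trans h3)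
        rw [h5]
        field_simp

/-! ### Bounds on the generating function of the coefficients. -/

theorem prod_le_mean_pow {n : ℕ} (hn : n ≠ 0) (z : Fin n → ℝ) (hz : ∀ i, 0 ≤ z i) :
    ∏ i, z i ≤ ((∑ i, z i) / n) ^ n := by
  have hn' : (0 : ℝ) < n := by positivity
  have h := Real.geom_mean_le_arith_mean univ (fun _ => (1 : ℝ)) z (fun _ _ => zero_le_one)
    (by simpa using Nat.pos_of_ne_zero hn) (fun i _ => hz i)
  simp only [Real.rpow_one, sum_const, card_univ, Fintype.card_fin, nsmul_eq_mul, mul_one,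
    one_mul] at h
  have h0 : 0 ≤ ∏ i, z i := prod_nonneg fun i _ => hz i
  calc ∏ i, z i = ((∏ i, z i) ^ (n : ℝ)⁻¹) ^ n := (Real.rpow_inv_natCast_pow h0 hn).symm
    _ ≤ _ := pow_le_pow_left₀ (Real.rpow_nonneg h0 _) h n

/-- The left side is the mean over `|z| = 1` of `∏ |a j √x z + √y|²`. AM-GM bounds this product
pointwise, and since `∑ a j = 0` the cross terms cancel, so the bound does not depend on `z`. -/
theorem sum_sq_elemSymm_mul_le {n : ℕ} (hn : n ≠ 0) (a : Fin n → ℝ) (ha : ∑ i, a i = 0) {x y : ℝ}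
    (hx : 0 ≤ x) (hy : 0 ≤ y) :
    ∑ l ∈ range (n + 1), elemSymm a l ^ 2 * x ^ l * y ^ (n - l) ≤
      (y + (∑ i, a i ^ 2) / n * x) ^ n := by
  set Q : Polynomial ℂ := ∑ l ∈ range (n + 1),
    Polynomial.C ((elemSymm a l * √x ^ l * √y ^ (n - l) : ℝ) : ℂ) * Polynomial.X ^ l with hQ
  have hcoeff : ∀ l ∈ range (n + 1),
      Q.coeff l = ((elemSymm a l * √x ^ l * √y ^ (n - l) : ℝ) : ℂ) := by
    intro l hl
    simp only [hQ, Polynomial.finsetSum_coeff, Polynomial.coeff_C_mul_X_pow, sum_ite_eq]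
    rw [if_pos hl]
  have heval : ∀ z : ℂ, Q.eval z = ∏ j, ((a j : ℂ) * (√x * z) + √y) := by
    intro z
    rw [prod_add_mul_eq_sum_elemSymm (fun j => (a j : ℂ))]
    simp only [hQ, Polynomial.eval_finsetSum, Polynomial.eval_mul, Polynomial.eval_C,
      Polynomial.eval_pow, Polynomial.eval_X]
    refine sum_congr rfl fun l _ => ?_
    rw [show elemSymm (fun j => (a j : ℂ)) l = ((elemSymm a l : ℝ) : ℂ) from
      map_elemSymm Complex.ofRealHom a l]
    push_cast
    ring
  have hsupp : Q.support ⊆ range (n + 1) := by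
    intro l hl
    by_contra h
    apply Polynomial.mem_support_iff.1 hl
    simp only [hQ, Polynomial.finsetSum_coeff, Polynomial.coeff_C_mul_X_pow, sum_ite_eq]
    rw [if_neg h]
  have hsum : ∑ l ∈ range (n + 1), elemSymm a l ^ 2 * x ^ l * y ^ (n - l)
      = ∑ i ∈ Q.support, ‖Q.coeff i‖ ^ 2 := by
    rw [sum_subset hsupp (fun i _ hi => by simp [Polynomial.notMem_support_iff.1 hi])]
    refine sum_congr rfl fun l hl => ?_
    rw [hcoeff l hl, Complex.norm_real, Real.norm_eq_abs, sq_abs, mul_pow, mul_pow, ← pow_mul,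
      ← pow_mul, mul_comm l, mul_comm (n - l), pow_mul, pow_mul, Real.sq_sqrt hx, Real.sq_sqrt hy]
  rw [hsum, Polynomial.sum_sq_norm_coeff_eq_circleAverage]
  apply Real.circleAverage_mono_on_of_le_circle
  · apply Continuous.intervalIntegrable
    have := (Q.continuous).comp (continuous_circleMap 0 1)
    exact (this.norm).pow 2
  · intro z hz
    have hz1 : Complex.normSq z = 1 := by
      have : ‖z‖ = 1 := by simpa using hz
      rw [Complex.normSq_eq_norm_sq, this, one_pow]
    have hfac : ∀ j, ‖(a j : ℂ) * (√x * z) + √y‖ ^ 2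
        = a j ^ 2 * x + 2 * (√x * √y * z.re) * a j + y := by
      intro j
      rw [← Complex.normSq_eq_norm_sq]
      rw [Complex.normSq_apply] at hz1 ⊢
      simp
      linear_combination a j ^ 2 * √x ^ 2 * hz1 + a j ^ 2 * Real.sq_sqrt hx + Real.sq_sqrt hy
    rw [heval, norm_prod, ← prod_pow]
    refine (prod_le_mean_pow hn _ fun j => sq_nonneg _).trans_eq ?_
    congr 1
    simp only [hfac, sum_add_distrib, ← sum_mul, ← mul_sum, ha]
    have : (n : ℝ) ≠ 0 := by exact_mod_cast hn
    simp
    field_simp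
    ring

theorem integral_pow_mul_one_sub_pow (m k : ℕ) :
    ∫ x in (0 : ℝ)..1, x ^ m * (1 - x) ^ k = (m.factorial * k.factorial : ℝ) / (m + k + 1).factorial := by
  induction m generalizing k with
  | zero =>
    have := intervalIntegral.integral_comp_sub_left (a := 0) (b := 1) (fun x : ℝ => x ^ k) 1
    simp only [pow_zero, one_mul, this]
    rw [integral_pow, zero_add, Nat.factorial_succ]
    have : (k.factorial : ℝ) ≠ 0 := by exact_mod_cast k.factorial_ne_zero
    push_cast
    simp
    field_simp
  | succ m ih =>
    have hI : ∀ i j : ℕ, IntervalIntegrable (fun x : ℝ => x ^ i * (1 - x) ^ j)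
        MeasureTheory.volume 0 1 := fun i j =>
      Continuous.intervalIntegrable (by fun_prop) _ _
    -- Integration by parts: this product vanishes at both endpoints.
    have h := intervalIntegral.integral_eq_sub_of_hasDerivAt (a := 0) (b := 1)
      (f := fun x : ℝ => x ^ (m + 1) * (1 - x) ^ (k + 1))
      (f' := fun x => (m + 1) * (x ^ m * (1 - x) ^ (k + 1))
        - (k + 1) * (x ^ (m + 1) * (1 - x) ^ k))
      (fun x _ => by
        have h1 := hasDerivAt_pow (m + 1) x
        have h2 := ((hasDerivAt_id x).const_sub 1).fun_pow (k + 1)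
        refine (h1.mul h2).congr_deriv ?_
        simp only [Nat.add_sub_cancel, id_eq, Nat.cast_add, Nat.cast_one]
        ring)
      (((hI _ _).const_mul _).sub ((hI _ _).const_mul _))
    rw [intervalIntegral.integral_sub ((hI _ _).const_mul _) ((hI _ _).const_mul _),
      intervalIntegral.integral_const_mul, intervalIntegral.integral_const_mul, ih] at h
    simp only [one_pow, sub_self, ne_eq, Nat.succ_ne_zero, not_false_eq_true, zero_pow, mul_zero,
      zero_mul] at h
    have h3 : (m + 1 + k + 1).factorial = (m + (k + 1) + 1).factorial := by congr 1; ring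
    rw [h3]
    have h4 : ((m + (k + 1) + 1).factorial : ℝ) ≠ 0 := by
      exact_mod_cast Nat.factorial_ne_zero _
    rw [Nat.factorial_succ m]
    rw [Nat.factorial_succ k] at h
    have h5 : ((k : ℝ) + 1) ≠ 0 := by positivity
    push_cast at h ⊢
    apply mul_left_cancel₀ h5
    linear_combination -h

theorem succ_mul_integral_pow_mul_one_sub_pow {n l : ℕ} (hl : l ≤ n) :
    (n + 1) * ∫ x in (0 : ℝ)..1, x ^ l * (1 - x) ^ (n - l) = 1 / n.choose l := by
  rw [integral_pow_mul_one_sub_pow, Nat.add_sub_cancel' hl, Nat.cast_choose ℝ hl,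
    Nat.factorial_succ]
  have h1 : (n.factorial : ℝ) ≠ 0 := by exact_mod_cast Nat.factorial_ne_zero _
  push_cast
  field_simp

theorem succ_mul_integral_one_sub_mul_pow_le (n : ℕ) {r : ℝ} (h0 : 0 ≤ r) (h1 : r < 1) :
    (n + 1) * ∫ x in (0 : ℝ)..1, (1 - x + r * x) ^ n ≤ 1 / (1 - r) := by
  have h := intervalIntegral.integral_eq_sub_of_hasDerivAt (a := 0) (b := 1)
      (f := fun x : ℝ => -(1 - x + r * x) ^ (n + 1))
      (f' := fun x => ((1 - r) * (n + 1)) * (1 - x + r * x) ^ n)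
      (fun x _ => by
        have h2 := ((((hasDerivAt_id' x).const_sub 1).fun_add
          ((hasDerivAt_id' x).const_mul r)).fun_pow (n + 1)).fun_neg
        refine h2.congr_deriv ?_
        simp only [Nat.add_sub_cancel, Nat.cast_add, Nat.cast_one]
        ring)
      (Continuous.intervalIntegrable (by fun_prop) _ _)
  rw [intervalIntegral.integral_const_mul] at h
  have h1r : 0 < 1 - r := by linarith
  rw [le_div_iff₀ h1r, mul_comm, ← mul_assoc, h]
  simp
  positivity

/-- Writing `1 / n.choose l` as a Beta integral allows integrating the previous bound at `(t x, 1 -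
x)` over `x ∈ [0, 1]`. -/
theorem sum_sq_elemSymm_div_choose_le {n : ℕ} (hn : n ≠ 0) (a : Fin n → ℝ) (ha : ∑ i, a i = 0)
    {t : ℝ} (ht : 0 ≤ t) (ht1 : (∑ i, a i ^ 2) / n * t < 1) :
    ∑ l ∈ range (n + 1), elemSymm a l ^ 2 / n.choose l * t ^ l ≤
      1 / (1 - (∑ i, a i ^ 2) / n * t) := by
  have hr : 0 ≤ (∑ i, a i ^ 2) / n * t :=
    mul_nonneg (div_nonneg (sum_nonneg fun i _ => sq_nonneg _) n.cast_nonneg) ht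
  refine le_trans ?_ (succ_mul_integral_one_sub_mul_pow_le n hr ht1)
  have hI : ∀ l ∈ range (n + 1), IntervalIntegrable
      (fun x : ℝ => elemSymm a l ^ 2 * t ^ l * (x ^ l * (1 - x) ^ (n - l)))
      MeasureTheory.volume 0 1 := fun l _ => Continuous.intervalIntegrable (by fun_prop) _ _
  calc _ = ((n : ℝ) + 1) * ∫ x in (0 : ℝ)..1, ∑ l ∈ range (n + 1),
        elemSymm a l ^ 2 * t ^ l * (x ^ l * (1 - x) ^ (n - l)) := by
        rw [intervalIntegral.integral_finsetSum hI, mul_sum]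
        refine sum_congr rfl fun l hl => ?_
        rw [intervalIntegral.integral_const_mul, mul_left_comm,
          succ_mul_integral_pow_mul_one_sub_pow (Nat.lt_succ_iff.1 (mem_range.1 hl))]
        ring
    _ ≤ _ := by
        refine mul_le_mul_of_nonneg_left ?_ (by positivity)
        refine intervalIntegral.integral_mono_on zero_le_one
          (Continuous.intervalIntegrable (by fun_prop) _ _)
          (Continuous.intervalIntegrable (by fun_prop) _ _) fun x hx => ?_
        have := sum_sq_elemSymm_mul_le hn a ha (mul_nonneg ht hx.1) (sub_nonneg.2 hx.2)
        rw [← mul_assoc] at this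
        refine le_of_eq_of_le (sum_congr rfl fun l _ => ?_) this
        rw [mul_pow]
        ring

/-- Geometric tail bound for nonnegative sequences whose generating function is dominated by
`1 / (1 - δ s)`. -/
theorem tail_le_of_generating_le {n : ℕ} {c : ℕ → ℝ} (hc : ∀ l, 0 ≤ c l) {δ : ℝ}
    (h0 : 0 < δ) (h1 : δ < 1)
    (h : ∀ s : ℝ, 0 ≤ s → δ * s < 1 → ∑ l ∈ range (n + 1), c l * s ^ l ≤ 1 / (1 - δ * s)) :
    ∑ l ∈ Ico 3 (n + 1), c l ≤ 16 * δ ^ 3 / (1 - δ) := by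
  have hsub : Ico 3 (n + 1) ⊆ range (n + 1) := fun l hl => mem_range.2 (mem_Ico.1 hl).2
  have h1' : 0 < 1 - δ := by linarith
  have key : ∀ s : ℝ, 1 ≤ s → δ * s < 1 →
      s ^ 3 * ∑ l ∈ Ico 3 (n + 1), c l ≤ 1 / (1 - δ * s) := by
    intro s hs hs1
    refine le_trans ?_ (h s (by linarith) hs1)
    rw [mul_sum]
    refine (sum_le_sum fun l hl => ?_).trans
      (sum_le_sum_of_subset_of_nonneg hsub fun l _ _ => mul_nonneg (hc l) (by positivity))
    rw [mul_comm]
    exact mul_le_mul_of_nonneg_left (pow_le_pow_right₀ hs (mem_Ico.1 hl).1) (hc l)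
  rcases le_total δ (1 / 2) with hδ | hδ
  -- Here `δ s = 1/2`, so the tail is at most `2 / s³ = 16 δ³`.
  · have := key (1 / (2 * δ)) (by rw [le_div_iff₀ (by positivity)]; linarith)
      (by field_simp; norm_num)
    rw [show δ * (1 / (2 * δ)) = 1 / 2 by field_simp] at this
    rw [div_pow, div_mul_eq_mul_div, div_le_iff₀ (by positivity)] at this
    rw [le_div_iff₀ h1']
    have h2 : ∑ l ∈ Ico 3 (n + 1), c l ≤ 16 * δ ^ 3 := by
      linarith
    have h3 : 0 ≤ ∑ l ∈ Ico 3 (n + 1), c l := sum_nonneg fun l _ => hc l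
    nlinarith
  -- With `δ ≥ 1/2`, already `16 δ³ ≥ 2`, so `s = 1` suffices.
  · have := key 1 le_rfl (by simpa using h1)
    rw [one_pow, one_mul, mul_one] at this
    refine this.trans (div_le_div_of_nonneg_right ?_ h1'.le)
    have : (1 / 2 : ℝ) ^ 3 ≤ δ ^ 3 := pow_le_pow_left₀ (by norm_num) hδ 3
    linarith

/-! ### The law of the sum and its distance to the binomial. -/

open MeasureTheory ProbabilityTheory in
theorem sum_real_map_sum_mul_pow {n : ℕ} (p : Fin n → unitInterval) {Ω : Type*} [MeasurableSpace Ω]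
    (μ : Measure Ω) [IsProbabilityMeasure μ] (X : Fin n → Ω → ℕ)
    (hX : ∀ j, HasLaw (X j) (bernoulliMeasure 1 0 (p j)) μ) (hind : iIndepFun X μ) (x y : ℝ) :
    ∑ k ∈ range (n + 1), (μ.map (fun ω => ∑ j, X j ω)).real {k} * y ^ k * x ^ (n - k) =
      ∏ j, ((1 - p j : ℝ) * x + p j * y) := by
  have hm : ∀ j, AEMeasurable (X j) μ := fun j => (hX j).aemeasurable
  -- Needed so that the truncated `n - ∑ X j` equals `∑ (1 - X j)` and the integrand factorizes.
  have hle : ∀ᵐ ω ∂μ, ∀ j, X j ω ≤ 1 := by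
    rw [ae_all_iff]
    intro j
    rw [(hX j).ae_iff (p := (· ≤ 1)) (by fun_prop), ae_iff]
    classical
    rw [bernoulliMeasure_apply _ (by measurability)]
    simp
  have hS : AEMeasurable (fun ω => ∑ j, X j ω) μ := by fun_prop
  have hSle : ∀ᵐ k ∂(μ.map (fun ω => ∑ j, X j ω)), k ∈ (range (n + 1) : Set ℕ) := by
    rw [ae_map_iff hS (by measurability)]
    filter_upwards [hle] with ω hω
    have : ∑ j, X j ω ≤ ∑ _j : Fin n, 1 := sum_le_sum fun j _ => hω j
    simp only [sum_const, card_univ, Fintype.card_fin, smul_eq_mul, mul_one] at this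
    simpa [Nat.lt_succ_iff] using this
  have hprob : IsProbabilityMeasure (μ.map (fun ω => ∑ j, X j ω)) :=
    Measure.isProbabilityMeasure_map hS
  calc _ = ∫ k in (range (n + 1) : Set ℕ), y ^ k * x ^ (n - k) ∂(μ.map (fun ω => ∑ j, X j ω)) := by
        rw [setIntegral_finset _ IntegrableOn.finset]
        simp [mul_assoc]
    _ = ∫ k, y ^ k * x ^ (n - k) ∂(μ.map (fun ω => ∑ j, X j ω)) := by
        rw [Measure.restrict_eq_self_of_ae_mem hSle]
    _ = ∫ ω, y ^ (∑ j, X j ω) * x ^ (n - ∑ j, X j ω) ∂μ :=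
        integral_map hS (by fun_prop)
    _ = ∫ ω, ∏ j, (y ^ X j ω * x ^ (1 - X j ω)) ∂μ := by
        refine integral_congr_ae ?_
        filter_upwards [hle] with ω hω
        rw [prod_mul_distrib, prod_pow_eq_pow_sum, prod_pow_eq_pow_sum]
        congr 2
        rw [sum_tsub_distrib _ fun j _ => hω j]
        simp
    _ = ∏ j, ∫ ω, y ^ X j ω * x ^ (1 - X j ω) ∂μ :=
        hind.integral_fun_prod_comp (f := fun _ k => y ^ k * x ^ (1 - k)) hm (fun _ => by fun_prop)
    _ = _ := by
        refine prod_congr rfl fun j _ => ?_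
        have := (hX j).integral_comp (f := fun k => y ^ k * x ^ (1 - k)) (by fun_prop)
        simp only [Function.comp_def] at this
        rw [this, integral_bernoulliMeasure]
        simp
        ring

theorem sum_sub_one_sq_mul_eq {s : Finset ℕ} {P b : ℕ → ℝ} (hb : ∀ k ∈ s, b k ≠ 0)
    (hP : ∑ k ∈ s, P k = 1) (hb1 : ∑ k ∈ s, b k = 1) :
    ∑ k ∈ s, |P k / b k - 1| ^ 2 * b k = ∑ k ∈ s, P k ^ 2 / b k - 1 := by
  have : ∀ k ∈ s, |P k / b k - 1| ^ 2 * b k = P k ^ 2 / b k - 2 * P k + b k := by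
    intro k hk
    have := hb k hk
    rw [sq_abs]
    field_simp
    ring
  rw [sum_congr rfl this, sum_add_distrib, sum_sub_distrib, ← mul_sum, hP, hb1]
  ring

theorem meanProb_pos {n : ℕ} (p : Fin n → unitInterval) (h : ¬ ∀ j, p j = 0) :
    0 < (meanProb p : ℝ) := by
  rw [not_forall] at h
  obtain ⟨i, hi⟩ := h
  have hn : 0 < n := i.pos
  refine div_pos (sum_pos' (fun j _ => (p j).2.1) ⟨i, mem_univ i, ?_⟩) (by exact_mod_cast hn)
  exact lt_of_le_of_ne (p i).2.1 fun h => hi (Subtype.ext h.symm)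

theorem meanProb_lt_one {n : ℕ} (p : Fin n → unitInterval) (h : ¬ ∀ j, p j = 1) :
    (meanProb p : ℝ) < 1 := by
  rw [not_forall] at h
  obtain ⟨i, hi⟩ := h
  have hn : (0 : ℝ) < n := by exact_mod_cast i.pos
  have hlt : ∑ j, (p j : ℝ) < ∑ _j : Fin n, (1 : ℝ) :=
    sum_lt_sum (fun j _ => (p j).2.2)
      ⟨i, mem_univ i, lt_of_le_of_ne (p i).2.2 fun h => hi (Subtype.ext h)⟩
  change (∑ j, (p j : ℝ)) / n < 1
  rw [div_lt_one hn]
  simpa using hlt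

theorem sum_sub_meanProb {n : ℕ} (hn : n ≠ 0) (p : Fin n → unitInterval) :
    ∑ j, ((p j : ℝ) - meanProb p) = 0 := by
  have hn' : (n : ℝ) ≠ 0 := by exact_mod_cast hn
  rw [sum_sub_distrib]
  simp only [meanProb, sum_const, card_univ, Fintype.card_fin, nsmul_eq_mul]
  field_simp
  ring

theorem deltaM_nonneg {n : ℕ} (p : Fin n → unitInterval) (m : ℕ) : 0 ≤ deltaM p m := by
  have h0 := (meanProb p).2.1
  have h1 := sub_nonneg.2 (meanProb p).2.2
  unfold deltaM
  have : 0 ≤ ∑ j, |(p j : ℝ) - (meanProb p : ℝ)| ^ m := sum_nonneg fun j _ => by positivity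
  positivity

theorem deltaM_two {n : ℕ} (p : Fin n → unitInterval) :
    deltaM p 2 = (∑ j, ((p j : ℝ) - meanProb p) ^ 2) / n *
      ((meanProb p : ℝ) * (1 - meanProb p))⁻¹ := by
  simp only [deltaM, sq_abs]
  norm_num
  ring

open MeasureTheory ProbabilityTheory in
theorem chiSqDist_map_sum_eq {n : ℕ} (p : Fin n → unitInterval) (h0 : ¬ ∀ j, p j = 0)
    (h1 : ¬ ∀ j, p j = 1) {Ω : Type*} [MeasurableSpace Ω] (μ : Measure Ω)
    [IsProbabilityMeasure μ] (X : Fin n → Ω → ℕ)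
    (hX : ∀ j, HasLaw (X j) (bernoulliMeasure 1 0 (p j)) μ) (hind : iIndepFun X μ) :
    chiSqDist n (μ.map (fun ω => ∑ j, X j ω)) (binomial n (meanProb p)) =
      ∑ l ∈ range (n + 1), elemSymm (fun j => (p j : ℝ) - meanProb p) l ^ 2 /
        (((meanProb p : ℝ) * (1 - meanProb p)) ^ l * n.choose l) - 1 := by
  have hp := meanProb_pos p h0
  have hq : (0 : ℝ) < 1 - meanProb p := sub_pos.2 (meanProb_lt_one p h1)
  have hpgf := sum_real_map_sum_mul_pow p μ X hX hind
  unfold chiSqDist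
  rw [sum_sub_one_sq_mul_eq, ← sum_sq_div_binomial_eq _ hp.ne' hq.ne' (by ring)
    (fun k => (μ.map (fun ω => ∑ j, X j ω)).real {k})]
  · simp only [binomial_real_singleton]
  · intro x y
    rw [hpgf]
    exact prod_congr rfl fun j _ => by ring
  · intro k hk
    rw [binomial_real_singleton]
    have : 0 < n.choose k := Nat.choose_pos (Nat.lt_succ_iff.1 (mem_range.1 hk))
    positivity
  · simpa using hpgf 1 1
  · simp only [binomial_real_singleton]
    have := add_pow (meanProb p : ℝ) (1 - meanProb p) n
    rw [add_sub_cancel, one_pow] at this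
    refine Eq.trans (sum_congr rfl fun k _ => ?_) this.symm
    ring

/-! ### The main estimate. -/

theorem theorem1 :
    ∃ C : ℝ, 0 < C ∧
      ∀ (n : ℕ), 2 ≤ n →
      ∀ (p : Fin n → unitInterval),
        ¬ (∀ j, p j = 0) → ¬ (∀ j, p j = 1) →
      ∀ {Ω : Type*} [MeasurableSpace Ω] (μ : MeasureTheory.Measure Ω)
        [MeasureTheory.IsProbabilityMeasure μ] (X : Fin n → Ω → ℕ),
        (∀ j, ProbabilityTheory.HasLaw (X j) (ProbabilityTheory.bernoulliMeasure 1 0 (p j)) μ) →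
        ProbabilityTheory.iIndepFun X μ →
        deltaM p 2 < 1 →
        (n : ℝ) / (2 * ((n : ℝ) - 1)) * deltaM p 2 ^ 2 ≤
            chiSqDist n (μ.map (fun ω => ∑ j, X j ω))
              (ProbabilityTheory.binomial n (meanProb p)) ∧
          chiSqDist n (μ.map (fun ω => ∑ j, X j ω))
              (ProbabilityTheory.binomial n (meanProb p)) ≤
            (n : ℝ) / (2 * ((n : ℝ) - 1)) * deltaM p 2 ^ 2 *
              (1 + C * (deltaM p 2 / (1 - deltaM p 2) +
                1 / Real.sqrt (n : ℝ) * (deltaM p 3 / deltaM p 2))) := by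
  -- `32 = 2 * 16`: the tail constant `16`, doubled because `c 2 ≥ δ² / 2`.
  refine ⟨32, by norm_num, fun n hn p h0 h1 Ω _ μ _ X hX hind hδ => ?_⟩
  have hp := meanProb_pos p h0
  have hq : (0 : ℝ) < 1 - meanProb p := sub_pos.2 (meanProb_lt_one p h1)
  have hn0 : n ≠ 0 := by omega
  have hn2 : (2 : ℝ) ≤ n := by exact_mod_cast hn
  have hsum := sum_sub_meanProb hn0 p
  rw [chiSqDist_map_sum_eq p h0 h1 μ X hX hind]
  set σ : ℝ := (meanProb p : ℝ) * (1 - meanProb p) with hσ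
  have hσ0 : 0 < σ := mul_pos hp hq
  set a : Fin n → ℝ := fun j => (p j : ℝ) - meanProb p with ha
  have hδ2 : deltaM p 2 = (∑ j, a j ^ 2) / n * σ⁻¹ := deltaM_two p
  have hδ0 := deltaM_nonneg p 2
  have hδ3 := deltaM_nonneg p 3
  set δ := deltaM p 2
  set c : ℕ → ℝ := fun l => elemSymm a l ^ 2 / (σ ^ l * n.choose l) with hc
  have hc0 : ∀ l, 0 ≤ c l := fun l => by positivity
  have hc2 : c 2 = n / (2 * ((n : ℝ) - 1)) * δ ^ 2 := by
    have he : elemSymm a 2 = -(∑ j, a j ^ 2) / 2 := by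
      have := two_mul_elemSymm_two a
      rw [hsum] at this
      linarith
    have : (n : ℝ) - 1 ≠ 0 := by linarith
    simp only [hc]
    rw [he, hδ2, Nat.cast_choose_two]
    field_simp
  have hsplit : ∑ l ∈ range (n + 1), c l - 1 = c 2 + ∑ l ∈ Ico 3 (n + 1), c l := by
    rw [range_eq_Ico, sum_eq_sum_Ico_succ_bot (by omega), sum_eq_sum_Ico_succ_bot (by omega),
      sum_eq_sum_Ico_succ_bot (by omega)]
    have e0 : c 0 = 1 := by simp [hc, elemSymm_zero]
    have e1 : c 1 = 0 := by simp [hc, elemSymm_one, hsum]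
    simp only [zero_add, Nat.reduceAdd, e0, e1]
    ring
  have hgen : ∀ s : ℝ, 0 ≤ s → δ * s < 1 →
      ∑ l ∈ range (n + 1), c l * s ^ l ≤ 1 / (1 - δ * s) := by
    intro s hs hs1
    rw [hδ2, mul_assoc] at hs1 ⊢
    refine le_of_eq_of_le (sum_congr rfl fun l _ => ?_)
      (sum_sq_elemSymm_div_choose_le hn0 a hsum (by positivity) hs1)
    simp only [hc, mul_pow, inv_pow]
    field_simp
  rw [hsplit, ← hc2]
  refine ⟨le_add_of_nonneg_right (sum_nonneg fun l _ => hc0 l), ?_⟩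
  have h1δ : 0 < 1 - δ := by linarith
  have htail : ∑ l ∈ Ico 3 (n + 1), c l ≤ c 2 * (32 * (δ / (1 - δ))) := by
    -- The generating bound needs `δ > 0`; for `δ = 0` every `a j`, hence the whole tail, vanishes.
    rcases hδ0.eq_or_lt with h | h
    · have hz : ∀ j, a j = 0 := by
        have : (∑ j, a j ^ 2) = 0 := by
          have := h.trans hδ2
          have hnn : (n : ℝ) ≠ 0 := by positivity
          field_simp at this
          linarith
        intro j
        have := (sum_eq_zero_iff_of_nonneg fun j _ => sq_nonneg (a j)).1 this j (mem_univ j)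
        exact pow_eq_zero_iff two_ne_zero |>.1 this
      rw [← h, zero_div, mul_zero, mul_zero]
      refine (sum_eq_zero fun l hl => ?_).le
      have : elemSymm a l = 0 := by
        refine sum_eq_zero fun t ht => ?_
        have hcard := (mem_powersetCard.1 ht).2
        obtain ⟨i, hi⟩ : t.Nonempty := card_pos.1 (by have := (mem_Ico.1 hl).1; omega)
        exact prod_eq_zero hi (hz i)
      simp [hc, this]
    · refine (tail_le_of_generating_le hc0 h hδ hgen).trans ?_
      have : δ ^ 2 / 2 ≤ c 2 := by
        rw [hc2, div_mul_eq_mul_div, div_le_div_iff₀ (by norm_num) (by linarith)]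
        nlinarith [sq_nonneg δ]
      calc _ = δ ^ 2 / 2 * (32 * (δ / (1 - δ))) := by ring
        _ ≤ _ := mul_le_mul_of_nonneg_right this (by positivity)
  -- The `δ₃` term enters only through its sign: `htail` alone gives the upper bound.
  have hextra : 0 ≤ c 2 * (32 * (1 / √(n : ℝ) * (deltaM p 3 / δ))) :=
    mul_nonneg (hc0 2) (by positivity)
  linarith
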